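/- Let $(\mathcal C,\otimes,I,\sigma)$ be a symmetric monoidal category (associators and unitors are suppressed in the formulas). A bialgebra in $\mathcal C$ is an object $A$ with morphisms $m\colon A\otimes A\to A$, $u_A\colon I\to A$, $\Delta\colon A\to A\otimes A$, $\epsilon_A\colon A\to I$ such that $u_A$ is a two-sided unit for $m$ ($m$ need not be associative), $(A,\Delta,\epsilon_A)$ is a coassociative counital coalgebra, and $\Delta m=(m\otimes m)(1\otimes\sigma_{A,A}\otimes 1)(\Delta\otimes\Delta)$, $\Delta u_A=u_A\otimes u_A$, $\epsilon_A m=\epsilon_A\otimes\epsilon_A$, $\epsilon_A u_A=1_I$. A morphism of bialgebras is a morphism of $\mathcal C$ preserving $m,u,\Delta,\epsilon$. A split extension of bialgebras consists of bialgebras $X,A,B$, bialgebra morphisms $\kappa\colon X\to A$, $\alpha\colon A\to B$, $e\colon B\to A$ and a morphism $\lambda\colon A\to X$ of $\mathcal C$ such that (1) $\lambda\kappa=1_X$, $\alpha e=1_B$; (2) $\lambda e=u_X\epsilon_B$, $\alpha\kappa=u_B\epsilon_X$; (3) $m((\kappa\lambda)\otimes(e\alpha))\Delta=1_A$; (4)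 $\lambda m(\kappa\otimes e)=1_X\otimes\epsilon_B$; (5) $(1_B\otimes\lambda m(e\otimes\kappa))(\Delta\otimes1_X)=(1_B\otimes\lambda m(e\otimes\kappa))(\sigma_{B,B}\otimes1_X)(\Delta\otimes1_X)$; (6) $m(m\otimes1_A)(\kappa\otimes e\otimes1_A)=m(1_A\otimes m)(\kappa\otimes e\otimes1_A)$; (7) $m(m\otimes1_A)(\kappa\otimes1_A\otimes e)=m(1_A\otimes m)(\kappa\otimes1_A\otimes e)$; (8) $m(m\otimes1_A)(1_A\otimes\kappa\otimes e)=m(1_A\otimes m)(1_A\otimes\kappa\otimes e)$; (9) $\lambda$ is a morphism of coalgebras and $\lambda u_A=u_X$. A morphism $(X,A,B,\kappa,\alpha,e,\lambda)\to(X',A',B',\kappa',\alpha',e',\lambda')$ is a triple of bialgebra morphisms $g\colon B\to B'$, $v\colon X\to X'$, $p\colon A\to A'$ with $p\kappa=\kappa'v$, $pe=e'g$, $g\alpha=\alpha'p$, $v\lambda=\lambda'p$. These form the category $\mathsf{SplitExt}(\mathsf{BiAlg}_{\mathcal C})$. An action of a bialgebra $B$ on a bialgebra $X$ is a morphism $\triangleright\colon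 B\otimes X\to X$ of $\mathcal C$ such that $\triangleright(u_B\otimes1_X)=1_X$, $\triangleright(1_B\otimes u_X)=u_X\epsilon_B$, $(1_B\otimes\triangleright)(\Delta\otimes1_X)=(1_B\otimes\triangleright)(\sigma_{B,B}\otimes1_X)(\Delta\otimes1_X)$, $\epsilon_X\triangleright=\epsilon_B\otimes\epsilon_X$ and $\Delta\triangleright=(\triangleright\otimes\triangleright)(1_B\otimes\sigma_{B,X}\otimes1_X)(\Delta\otimes\Delta)$. A morphism from $\triangleright\colon B\otimes X\to X$ to $\triangleright'\colon B'\otimes X'\to X'$ is a pair of bialgebra morphisms $g\colon B\to B'$, $v\colon X\to X'$ with $v\,\triangleright=\triangleright'(g\otimes v)$. These form the category $\mathsf{Act}(\mathsf{BiAlg}_{\mathcal C})$. For an action, let $X\rtimes B$ be the object $X\otimes B$ with unit $u_X\otimes u_B$, counit $\epsilon_X\otimes\epsilon_B$, comultiplication $(1_X\otimes\sigma_{X,B}\otimes1_B)(\Delta\otimes\Delta)$ and multiplication $(m\otimes m)(1_X\otimes\triangleright\otimes1_B\otimes1_B)(1_X\otimes1_B\otimes\sigma_{B,X}\otimes1_B)(1_X\otimes\Delta\otimes1_X\otimes1_B)$.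 **Theorem.** The categories $\mathsf{SplitExt}(\mathsf{BiAlg}_{\mathcal C})$ and $\mathsf{Act}(\mathsf{BiAlg}_{\mathcal C})$ are equivalent. More precisely, there are well-defined functors $F\colon\mathsf{SplitExt}(\mathsf{BiAlg}_{\mathcal C})\to\mathsf{Act}(\mathsf{BiAlg}_{\mathcal C})$, sending a split extension to the action $\triangleright=\lambda m(e\otimes\kappa)$ of $B$ on $X$ and $(g,v,p)$ to $(g,v)$, and $G\colon\mathsf{Act}(\mathsf{BiAlg}_{\mathcal C})\to\mathsf{SplitExt}(\mathsf{BiAlg}_{\mathcal C})$, sending an action to the split extension with middle bialgebra $X\rtimes B$ and $\kappa=1_X\otimes u_B$, $e=u_X\otimes1_B$, $\lambda=1_X\otimes\epsilon_B$, $\alpha=\epsilon_X\otimes1_B$, and $(g,v)$ to $(g,v,v\otimes g)$; and $F$ and $G$ form an equivalence of categories, quasi-inverse to each other. -/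

import Mathlib

open CategoryTheory MonoidalCategory

universe v u

namespace NonassocBialg

open scoped ComonObj

section

variable {C : Type u} [Category.{v} C] [MonoidalCategory C] [SymmetricCategory C]

/-- The axioms making a coassociative counital coalgebra `A`, with a unit `one` and a
multiplication `mul`, a (not necessarily associative) bialgebra: `one` is a two-sided unit of `mul`,
and the comultiplication and the counit are morphisms of unital algebras. -/
structure IsBialgebra (A : C) [ComonObj A] (one : 𝟙_ C ⟶ A) (mul : A ⊗ A ⟶ A) : Prop where
  one_mul : one ▷ A ≫ mul = (λ_ A).hom
  mul_one : A ◁ one ≫ mul = (ρ_ A).hom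
  mul_comul : mul ≫ Δ[A] = (Δ[A] ⊗ₘ Δ[A]) ≫ tensorμ A A A A ≫ (mul ⊗ₘ mul)
  one_comul : one ≫ Δ[A] = (λ_ (𝟙_ C)).inv ≫ (one ⊗ₘ one)
  mul_counit : mul ≫ ε[A] = (ε[A] ⊗ₘ ε[A]) ≫ (λ_ (𝟙_ C)).hom
  one_counit : one ≫ ε[A] = 𝟙 (𝟙_ C)

variable (C) in
/-- A (not necessarily associative) bialgebra in the symmetric monoidal category `C`. The coalgebra
part is coassociative and counital. -/
structure BiAlg where
  /-- the underlying object -/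
  obj : C
  [comon : ComonObj obj]
  /-- the unit -/
  one : 𝟙_ C ⟶ obj
  /-- the multiplication -/
  mul : obj ⊗ obj ⟶ obj
  isBialgebra : IsBialgebra obj one mul

attribute [instance] BiAlg.comon

/-- A morphism of `C` is a morphism of bialgebras if it is a morphism of unital algebras and a
morphism of counital coalgebras. -/
structure IsBialgHom (A B : BiAlg C) (f : A.obj ⟶ B.obj) : Prop where
  one_hom : A.one ≫ f = B.one
  mul_hom : A.mul ≫ f = (f ⊗ₘ f) ≫ B.mul
  isComonHom : IsComonHom f

theorem IsBialgHom.id (A : BiAlg C) : IsBialgHom A A (𝟙 A.obj) where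
  one_hom := by simp
  mul_hom := by simp
  isComonHom := inferInstance

theorem IsBialgHom.comp {A B D : BiAlg C} {f : A.obj ⟶ B.obj} {g : B.obj ⟶ D.obj}
    (hf : IsBialgHom A B f) (hg : IsBialgHom B D g) : IsBialgHom A D (f ≫ g) where
  one_hom := by rw [← Category.assoc, hf.one_hom, hg.one_hom]
  mul_hom := by
    rw [← Category.assoc, hf.mul_hom, Category.assoc, hg.mul_hom, ← Category.assoc,
      tensorHom_comp_tensorHom]
  isComonHom := by
    have := hf.isComonHom
    have := hg.isComonHom
    infer_instance

/-! ### Actions of bialgebras -/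

/-- `act : B ⊗ X ⟶ X` is an action of the bialgebra `B` on the bialgebra `X`. -/
structure IsAction (B X : BiAlg C) (act : B.obj ⊗ X.obj ⟶ X.obj) : Prop where
  one_act : B.one ▷ X.obj ≫ act = (λ_ X.obj).hom
  act_one : B.obj ◁ X.one ≫ act = (ρ_ B.obj).hom ≫ ε[B.obj] ≫ X.one
  comul_act : Δ[B.obj] ▷ X.obj ≫ (α_ B.obj B.obj X.obj).hom ≫ B.obj ◁ act =
    Δ[B.obj] ▷ X.obj ≫ (β_ B.obj B.obj).hom ▷ X.obj ≫ (α_ B.obj B.obj X.obj).hom ≫ B.obj ◁ act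
  act_counit : act ≫ ε[X.obj] = (ε[B.obj] ⊗ₘ ε[X.obj]) ≫ (λ_ (𝟙_ C)).hom
  act_comul : act ≫ Δ[X.obj] =
    (Δ[B.obj] ⊗ₘ Δ[X.obj]) ≫ tensorμ B.obj B.obj X.obj X.obj ≫ (act ⊗ₘ act)

variable (C) in
/-- An action of bialgebras in `C`: two bialgebras `B` and `X` and an action of `B` on `X`. -/
structure Act where
  /-- the acting bialgebra -/
  B : BiAlg C
  /-- the bialgebra acted on -/
  X : BiAlg C
  /-- the action morphism -/
  act : B.obj ⊗ X.obj ⟶ X.obj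
  isAction : IsAction B X act

/-- `(g, v)` is a morphism from the action `act` to the action `act'`. -/
structure IsActionHom {B X B' X' : BiAlg C} (act : B.obj ⊗ X.obj ⟶ X.obj)
    (act' : B'.obj ⊗ X'.obj ⟶ X'.obj) (g : B.obj ⟶ B'.obj) (v : X.obj ⟶ X'.obj) : Prop where
  isBialgHom_g : IsBialgHom B B' g
  isBialgHom_v : IsBialgHom X X' v
  act_comp : act ≫ v = (g ⊗ₘ v) ≫ act'

/-- Morphisms of actions of bialgebras. -/
@[ext]
structure Act.Hom (T T' : Act C) where
  /-- the component on the acting bialgebras -/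
  g : T.B.obj ⟶ T'.B.obj
  /-- the component on the bialgebras acted on -/
  v : T.X.obj ⟶ T'.X.obj
  isActionHom : IsActionHom T.act T'.act g v

/-- The category of actions of bialgebras in `C`. -/
instance : Category (Act C) where
  Hom := Act.Hom
  id T := ⟨𝟙 _, 𝟙 _, .id _, .id _, by simp⟩
  comp f f' := ⟨f.g ≫ f'.g, f.v ≫ f'.v,
    f.isActionHom.isBialgHom_g.comp f'.isActionHom.isBialgHom_g,
    f.isActionHom.isBialgHom_v.comp f'.isActionHom.isBialgHom_v, by
      rw [← Category.assoc, f.isActionHom.act_comp, Category.assoc, f'.isActionHom.act_comp,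
        ← Category.assoc, tensorHom_comp_tensorHom]⟩

/-! ### Split extensions of bialgebras -/

/-- The diagram `κ : X ⟶ A`, `α : A ⟶ B`, `e : B ⟶ A`, `l : A ⟶ X` in `C` is a split extension
of bialgebras. Here `l` is only a morphism of `C`. -/
structure IsSplitExtension (X A B : BiAlg C) (κ : X.obj ⟶ A.obj) (α : A.obj ⟶ B.obj)
    (e : B.obj ⟶ A.obj) (l : A.obj ⟶ X.obj) : Prop where
  isBialgHom_κ : IsBialgHom X A κ
  isBialgHom_α : IsBialgHom A B α
  isBialgHom_e : IsBialgHom B A e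
  /-- `l` retracts `κ` and `e` is a section of `α` -/
  κ_l : κ ≫ l = 𝟙 X.obj
  e_α : e ≫ α = 𝟙 B.obj
  /-- the composites `l ∘ e` and `α ∘ κ` are trivial -/
  e_l : e ≫ l = ε[B.obj] ≫ X.one
  κ_α : κ ≫ α = ε[X.obj] ≫ B.one
  /-- every `a` is `κ (l a₁) * e (α a₂)` -/
  decomp : Δ[A.obj] ≫ ((l ≫ κ) ⊗ₘ (α ≫ e)) ≫ A.mul = 𝟙 A.obj
  /-- `l (κ x * e b) = x ε(b)` -/
  mul_l : (κ ⊗ₘ e) ≫ A.mul ≫ l = X.obj ◁ ε[B.obj] ≫ (ρ_ X.obj).hom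
  /-- `b₁ ⊗ l (e b₂ * κ x) = b₂ ⊗ l (e b₁ * κ x)` -/
  comul_mul : Δ[B.obj] ▷ X.obj ≫ (α_ B.obj B.obj X.obj).hom ≫
      B.obj ◁ (e ⊗ₘ κ) ≫ B.obj ◁ A.mul ≫ B.obj ◁ l =
    Δ[B.obj] ▷ X.obj ≫ (β_ B.obj B.obj).hom ▷ X.obj ≫ (α_ B.obj B.obj X.obj).hom ≫
      B.obj ◁ (e ⊗ₘ κ) ≫ B.obj ◁ A.mul ≫ B.obj ◁ l
  /-- `(κ x * e b) * a = κ x * (e b * a)` -/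
  assoc_κ_e_id : ((κ ⊗ₘ e) ⊗ₘ 𝟙 A.obj) ≫ A.mul ▷ A.obj ≫ A.mul =
    ((κ ⊗ₘ e) ⊗ₘ 𝟙 A.obj) ≫ (α_ A.obj A.obj A.obj).hom ≫ A.obj ◁ A.mul ≫ A.mul
  /-- `(κ x * a) * e b = κ x * (a * e b)` -/
  assoc_κ_id_e : ((κ ⊗ₘ 𝟙 A.obj) ⊗ₘ e) ≫ A.mul ▷ A.obj ≫ A.mul =
    ((κ ⊗ₘ 𝟙 A.obj) ⊗ₘ e) ≫ (α_ A.obj A.obj A.obj).hom ≫ A.obj ◁ A.mul ≫ A.mul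
  /-- `(a * κ x) * e b = a * (κ x * e b)` -/
  assoc_id_κ_e : ((𝟙 A.obj ⊗ₘ κ) ⊗ₘ e) ≫ A.mul ▷ A.obj ≫ A.mul =
    ((𝟙 A.obj ⊗ₘ κ) ⊗ₘ e) ≫ (α_ A.obj A.obj A.obj).hom ≫ A.obj ◁ A.mul ≫ A.mul
  /-- `l` is a morphism of coalgebras preserving the unit -/
  isComonHom_l : IsComonHom l
  one_l : A.one ≫ l = X.one

variable (C) in
/-- A split extension of bialgebras in `C`. -/
structure SplitExt where
  /-- the kernel part -/
  X : BiAlg C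
  /-- the middle bialgebra -/
  A : BiAlg C
  /-- the quotient part -/
  B : BiAlg C
  /-- the inclusion -/
  κ : X.obj ⟶ A.obj
  /-- the split epimorphism -/
  α : A.obj ⟶ B.obj
  /-- the section of `α` -/
  e : B.obj ⟶ A.obj
  /-- the retraction of `κ`, a morphism of `C` -/
  l : A.obj ⟶ X.obj
  isSplitExtension : IsSplitExtension X A B κ α e l

/-- `(g, v, p)` is a morphism of split extensions: three morphisms of bialgebras that commute with
all the structure maps. -/
structure IsSplitExtHom (S S' : SplitExt C) (g : S.B.obj ⟶ S'.B.obj) (v : S.X.obj ⟶ S'.X.obj)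
    (p : S.A.obj ⟶ S'.A.obj) : Prop where
  isBialgHom_g : IsBialgHom S.B S'.B g
  isBialgHom_v : IsBialgHom S.X S'.X v
  isBialgHom_p : IsBialgHom S.A S'.A p
  κ_comp : S.κ ≫ p = v ≫ S'.κ
  α_comp : S.α ≫ g = p ≫ S'.α
  e_comp : S.e ≫ p = g ≫ S'.e
  l_comp : S.l ≫ v = p ≫ S'.l

/-- Morphisms of split extensions of bialgebras. -/
@[ext]
structure SplitExt.Hom (S S' : SplitExt C) where
  /-- the component on the quotient parts -/
  g : S.B.obj ⟶ S'.B.obj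
  /-- the component on the kernel parts -/
  v : S.X.obj ⟶ S'.X.obj
  /-- the component on the middle bialgebras -/
  p : S.A.obj ⟶ S'.A.obj
  isSplitExtHom : IsSplitExtHom S S' g v p

/-- The category of split extensions of bialgebras in `C`. -/
instance : Category (SplitExt C) where
  Hom := SplitExt.Hom
  id S := ⟨𝟙 _, 𝟙 _, 𝟙 _, .id _, .id _, .id _, by simp, by simp, by simp, by simp⟩
  comp {S S' S''} f f' := ⟨f.g ≫ f'.g, f.v ≫ f'.v, f.p ≫ f'.p, by
    have h := f.isSplitExtHom
    have h' := f'.isSplitExtHom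
    refine ⟨h.isBialgHom_g.comp h'.isBialgHom_g, h.isBialgHom_v.comp h'.isBialgHom_v,
      h.isBialgHom_p.comp h'.isBialgHom_p, ?_, ?_, ?_, ?_⟩
    · rw [← Category.assoc, h.κ_comp, Category.assoc, h'.κ_comp, Category.assoc]
    · rw [← Category.assoc, h.α_comp, Category.assoc, h'.α_comp, Category.assoc]
    · rw [← Category.assoc, h.e_comp, Category.assoc, h'.e_comp, Category.assoc]
    · rw [← Category.assoc, h.l_comp, Category.assoc, h'.l_comp, Category.assoc]⟩

/-! ### The functor from split extensions to actions -/

/-- The morphism `l ∘ m ∘ (e ⊗ κ) : B ⊗ X ⟶ X` attached to a split extension. -/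
def SplitExt.inducedAct (S : SplitExt C) : S.B.obj ⊗ S.X.obj ⟶ S.X.obj :=
  (S.e ⊗ₘ S.κ) ≫ S.A.mul ≫ S.l

/-- The functor sending a split extension to its induced action, and `(g, v, p)` to `(g, v)`. The
arguments say that these values are actions and morphisms of actions. -/
def SplitExt.toAct (hobj : ∀ S : SplitExt C, IsAction S.B S.X S.inducedAct)
    (hmap : ∀ (S S' : SplitExt C) (f : S ⟶ S'),
      IsActionHom S.inducedAct S'.inducedAct f.g f.v) :
    SplitExt C ⥤ Act C where
  obj S := ⟨S.B, S.X, S.inducedAct, hobj S⟩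
  map {S S'} f := ⟨f.g, f.v, hmap S S' f⟩

/-! ### The functor from actions to split extensions: the semidirect product

The coalgebra structure on `X ⊗ B` is the tensor product coalgebra of Mathlib, with
comultiplication `(Δ ⊗ Δ) ≫ tensorμ X X B B` and counit `ε ⊗ ε`. -/

/-- The unit `u_X ⊗ u_B` of the semidirect product. -/
def Act.sdOne (T : Act C) : 𝟙_ C ⟶ T.X.obj ⊗ T.B.obj :=
  (λ_ (𝟙_ C)).inv ≫ (T.X.one ⊗ₘ T.B.one)

/-- The multiplication of the semidirect product; on elements
`(x ⊗ b) (x' ⊗ b') = x (b₁ ▷ x') ⊗ b₂ b'`. -/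
def Act.sdMul (T : Act C) :
    (T.X.obj ⊗ T.B.obj) ⊗ (T.X.obj ⊗ T.B.obj) ⟶ T.X.obj ⊗ T.B.obj :=
  (T.X.obj ◁ Δ[T.B.obj] ≫ (α_ T.X.obj T.B.obj T.B.obj).inv) ▷ (T.X.obj ⊗ T.B.obj) ≫
    tensorμ (T.X.obj ⊗ T.B.obj) T.B.obj T.X.obj T.B.obj ≫
      (((α_ T.X.obj T.B.obj T.X.obj).hom ≫ T.X.obj ◁ T.act ≫ T.X.mul) ⊗ₘ T.B.mul)

/-- The semidirect product `X ⋊ B`, given that its structure maps form a bialgebra. -/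
def Act.sd (T : Act C) (h : IsBialgebra (T.X.obj ⊗ T.B.obj) T.sdOne T.sdMul) : BiAlg C where
  obj := T.X.obj ⊗ T.B.obj
  one := T.sdOne
  mul := T.sdMul
  isBialgebra := h

/-- `i₁ = 1_X ⊗ u_B`. -/
def Act.i₁ (T : Act C) : T.X.obj ⟶ T.X.obj ⊗ T.B.obj := (ρ_ T.X.obj).inv ≫ T.X.obj ◁ T.B.one

/-- `i₂ = u_X ⊗ 1_B`. -/
def Act.i₂ (T : Act C) : T.B.obj ⟶ T.X.obj ⊗ T.B.obj := (λ_ T.B.obj).inv ≫ T.X.one ▷ T.B.obj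

/-- `π₁ = 1_X ⊗ ε_B`. -/
def Act.π₁ (T : Act C) : T.X.obj ⊗ T.B.obj ⟶ T.X.obj := T.X.obj ◁ ε[T.B.obj] ≫ (ρ_ T.X.obj).hom

/-- `π₂ = ε_X ⊗ 1_B`. -/
def Act.π₂ (T : Act C) : T.X.obj ⊗ T.B.obj ⟶ T.B.obj := ε[T.X.obj] ▷ T.B.obj ≫ (λ_ T.B.obj).hom

/-- The split extension `X ⟶ X ⋊ B ⇄ B`, given that it is one. -/
def Act.sdSplitExt (T : Act C) (h : IsBialgebra (T.X.obj ⊗ T.B.obj) T.sdOne T.sdMul)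
    (h' : IsSplitExtension T.X (T.sd h) T.B T.i₁ T.π₂ T.i₂ T.π₁) : SplitExt C where
  X := T.X
  A := T.sd h
  B := T.B
  κ := T.i₁
  α := T.π₂
  e := T.i₂
  l := T.π₁
  isSplitExtension := h'

/-- The functor sending an action to its semidirect product split extension, and `(g, v)` to
`(g, v, v ⊗ g)`. The arguments say that these values are bialgebras, split extensions and morphisms
of split extensions. -/
def Act.toSplitExt
    (hbialg : ∀ T : Act C, IsBialgebra (T.X.obj ⊗ T.B.obj) T.sdOne T.sdMul)
    (hobj : ∀ T : Act C, IsSplitExtension T.X (T.sd (hbialg T)) T.B T.i₁ T.π₂ T.i₂ T.π₁)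
    (hmap : ∀ (T T' : Act C) (f : T ⟶ T'),
      IsSplitExtHom (T.sdSplitExt (hbialg T) (hobj T)) (T'.sdSplitExt (hbialg T') (hobj T'))
        f.g f.v (f.v ⊗ₘ f.g)) :
    Act C ⥤ SplitExt C where
  obj T := T.sdSplitExt (hbialg T) (hobj T)
  map {T T'} f := ⟨f.g, f.v, f.v ⊗ₘ f.g, hmap T T' f⟩
  map_id _ := SplitExt.Hom.ext rfl rfl (id_tensorHom_id _ _)
  map_comp _ _ := SplitExt.Hom.ext rfl rfl (tensorHom_comp_tensorHom _ _ _ _).symm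

end

end NonassocBialg

/-!
The proof works with generalized elements. For a comonoid `Y`, two morphisms `f : Y ⟶ A` and
`g : Y ⟶ B` have a pairing `pair f g = Δ ≫ (f ⊗ g) : Y ⟶ A ⊗ B`, in Sweedler notation
`y ↦ f y₁ ⊗ g y₂`. Pairings are associative, counital and natural; precomposition with a morphism
of comonoids distributes over them, and on `A ⊗ B` the identity is the pairing of the two
projections. So a morphism out of a tensor product of comonoids is determined by its values on
pairings (`tensor_ext` and its variants), as if `⊗` were a cartesian product. What fails in the
absence of cocommutativity is the symmetry of pairings; the predicate `Cocomm f g`, meaning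
`f y₁ ⊗ g y₂ = f y₂ ⊗ g y₁`, records when it holds. It holds for the projections onto different
tensor factors, and it is inherited by composites and by pairings, so it can be left to instance
search. The pairing of two comonoid morphisms with `Cocomm f g` is a comonoid morphism.

In these terms the bialgebra axioms say that `m` and `u` are comonoid morphisms, and the
cocommutativity axiom of an action says exactly that `b` and `b ▷ x` satisfy `Cocomm`
(`Act.cocomm_act`). This is what makes the multiplication
`(x, b) (x', b') = (x (b ▷ x'), b b')` of the semidirect product a comonoid morphism. The axioms of
a split extension for it become computations with this formula, which never reassociate a product
in `X` or in `B`.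

For a split extension with middle object `A`, the comparison map `X ⋊ B ⟶ A`, `(x, b) ↦ κ x * e b`,
is inverted by `a ↦ (l a₁, α a₂)`. It is multiplicative (`SplitExt.pair_mul_mul`): the partial
associativity axioms reduce `(κ x * e b) * (κ x' * e b')` to `κ x * ((e b * κ x') * e b')`, the
decomposition of elements of `A` gives `e b * κ x' = κ (b ▷ x') * e b`
(`SplitExt.pair_mul_of_e_κ`), and partial associativity regroups the result. These maps are the
components of a natural isomorphism from the composite of the two functors on split extensions to
the identity. The other composite returns an action with the same action morphism
(`Act.tensorHom_sdMul_π₁`).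
-/

namespace NonassocBialg

open scoped ComonObj

/-! ### Pairings of morphisms out of a comonoid -/

section

variable {C : Type u} [Category.{v} C] [MonoidalCategory C]
variable {Y Z A B D E : C} [ComonObj Y] [ComonObj Z]

/-- The morphism `y ↦ f y₁ ⊗ g y₂` out of a comonoid `Y`: the comultiplication of `Y` followed by
`f ⊗ g`. -/
def pair (f : Y ⟶ A) (g : Y ⟶ B) : Y ⟶ A ⊗ B := Δ[Y] ≫ (f ⊗ₘ g)

@[simp]
theorem pair_tensorHom (f : Y ⟶ A) (g : Y ⟶ B) (a : A ⟶ D) (b : B ⟶ E) :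
    pair f g ≫ (a ⊗ₘ b) = pair (f ≫ a) (g ≫ b) := by
  simp [pair]

@[simp]
theorem pair_tensorHom_assoc (f : Y ⟶ A) (g : Y ⟶ B) (a : A ⟶ D) (b : B ⟶ E) {W : C}
    (k : D ⊗ E ⟶ W) :
    pair f g ≫ (a ⊗ₘ b) ≫ k = pair (f ≫ a) (g ≫ b) ≫ k := by
  rw [← Category.assoc, pair_tensorHom]

@[simp]
theorem pair_whiskerRight (f : Y ⟶ A) (g : Y ⟶ B) (a : A ⟶ D) :
    pair f g ≫ a ▷ B = pair (f ≫ a) g := by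
  rw [← tensorHom_id, pair_tensorHom, Category.comp_id]

@[simp]
theorem pair_whiskerRight_assoc (f : Y ⟶ A) (g : Y ⟶ B) (a : A ⟶ D) {W : C} (k : D ⊗ B ⟶ W) :
    pair f g ≫ a ▷ B ≫ k = pair (f ≫ a) g ≫ k := by
  rw [← Category.assoc, pair_whiskerRight]

@[simp]
theorem pair_whiskerLeft (f : Y ⟶ A) (g : Y ⟶ B) (b : B ⟶ E) :
    pair f g ≫ A ◁ b = pair f (g ≫ b) := by
  rw [← id_tensorHom, pair_tensorHom, Category.comp_id]

@[simp]
theorem pair_whiskerLeft_assoc (f : Y ⟶ A) (g : Y ⟶ B) (b : B ⟶ E) {W : C} (k : A ⊗ E ⟶ W) :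
    pair f g ≫ A ◁ b ≫ k = pair f (g ≫ b) ≫ k := by
  rw [← Category.assoc, pair_whiskerLeft]

theorem comp_pair (q : Z ⟶ Y) [IsComonHom q] (f : Y ⟶ A) (g : Y ⟶ B) :
    q ≫ pair f g = pair (q ≫ f) (q ≫ g) := by
  simp [pair]

theorem comp_pair_assoc (q : Z ⟶ Y) [IsComonHom q] (f : Y ⟶ A) (g : Y ⟶ B) {W : C}
    (k : A ⊗ B ⟶ W) :
    q ≫ pair f g ≫ k = pair (q ≫ f) (q ≫ g) ≫ k := by
  rw [← Category.assoc, comp_pair]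

@[simp]
theorem pair_associator_hom (f : Y ⟶ A) (g : Y ⟶ B) (h : Y ⟶ D) :
    pair (pair f g) h ≫ (α_ A B D).hom = pair f (pair g h) := by
  -- both sides are brought to the form of an iterated comultiplication followed by `f ⊗ g ⊗ h`
  have h1 : pair (pair f g) h = Δ[Y] ≫ Δ[Y] ▷ Y ≫ ((f ⊗ₘ g) ⊗ₘ h) := by
    simp only [pair, whiskerRight_comp_tensorHom]
  have h2 : pair f (pair g h) = Δ[Y] ≫ Y ◁ Δ[Y] ≫ (f ⊗ₘ g ⊗ₘ h) := by
    simp only [pair, whiskerLeft_comp_tensorHom]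
  rw [h1, h2, ComonObj.comul_assoc_assoc]
  simp only [Category.assoc, associator_naturality]

@[simp]
theorem pair_associator_hom_assoc (f : Y ⟶ A) (g : Y ⟶ B) (h : Y ⟶ D) {W : C}
    (k : A ⊗ B ⊗ D ⟶ W) :
    pair (pair f g) h ≫ (α_ A B D).hom ≫ k = pair f (pair g h) ≫ k := by
  rw [← Category.assoc, pair_associator_hom]

@[simp]
theorem pair_associator_inv (f : Y ⟶ A) (g : Y ⟶ B) (h : Y ⟶ D) :
    pair f (pair g h) ≫ (α_ A B D).inv = pair (pair f g) h := by
  rw [← pair_associator_hom, Category.assoc, Iso.hom_inv_id, Category.comp_id]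

@[simp]
theorem pair_associator_inv_assoc (f : Y ⟶ A) (g : Y ⟶ B) (h : Y ⟶ D) {W : C}
    (k : (A ⊗ B) ⊗ D ⟶ W) :
    pair f (pair g h) ≫ (α_ A B D).inv ≫ k = pair (pair f g) h ≫ k := by
  rw [← Category.assoc, pair_associator_inv]

@[simp]
theorem pair_counit_left (f : Y ⟶ A) : pair ε[Y] f ≫ (λ_ A).hom = f := by
  simp [pair]

@[simp]
theorem pair_counit_right (f : Y ⟶ A) : pair f ε[Y] ≫ (ρ_ A).hom = f := by
  simp [pair]

theorem pair_counit_right_assoc (f : Y ⟶ A) {W : C} (k : A ⟶ W) :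
    pair f ε[Y] ≫ (ρ_ A).hom ≫ k = f ≫ k := by
  rw [← Category.assoc, pair_counit_right]

theorem leftUnitor_inv_eq_pair : (λ_ Y).inv = pair ε[Y] (𝟙 Y) := by
  rw [pair, ComonObj.counit_comul_hom, Category.id_comp]

theorem rightUnitor_inv_eq_pair : (ρ_ Y).inv = pair (𝟙 Y) ε[Y] := by
  rw [pair, ComonObj.comul_counit_hom, Category.id_comp]

theorem comp_comul (f : Z ⟶ Y) [IsComonHom f] : f ≫ Δ[Y] = pair f f := by simp [pair]

variable (A B) in
/-- The projection `A ⊗ B ⟶ A` given by the counit of `B`. -/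
def fst [ComonObj B] : A ⊗ B ⟶ A := A ◁ ε[B] ≫ (ρ_ A).hom

variable (A B) in
/-- The projection `A ⊗ B ⟶ B` given by the counit of `A`. -/
def snd [ComonObj A] : A ⊗ B ⟶ B := ε[A] ▷ B ≫ (λ_ B).hom

@[simp]
theorem pair_fst [ComonObj B] (f : Y ⟶ A) (g : Y ⟶ B) [IsComonHom g] :
    pair f g ≫ fst A B = f := by
  simp [fst]

@[simp]
theorem pair_snd [ComonObj A] (f : Y ⟶ A) (g : Y ⟶ B) [IsComonHom f] :
    pair f g ≫ snd A B = g := by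
  simp [snd]

variable [BraidedCategory C]

/-- The relation `f y₁ ⊗ g y₂ = f y₂ ⊗ g y₁` between two morphisms `f` and `g` out of a comonoid:
the order in which they are paired does not matter. It is a class so that it can be derived
from the shape of `f` and `g`. -/
class Cocomm (f : Y ⟶ A) (g : Y ⟶ B) : Prop where
  pair_braiding : pair f g ≫ (β_ A B).hom = pair g f

attribute [simp] Cocomm.pair_braiding

instance Cocomm.counit_right (f : Y ⟶ A) : Cocomm f ε[Y] where
  pair_braiding := by simp [pair]

theorem Cocomm.pair_braiding_assoc (f : Y ⟶ A) (g : Y ⟶ B) [Cocomm f g] {W : C}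
    (k : B ⊗ A ⟶ W) : pair f g ≫ (β_ A B).hom ≫ k = pair g f ≫ k := by
  rw [← Category.assoc, Cocomm.pair_braiding]

theorem pair_tensorμ (f : Y ⟶ A) (g : Y ⟶ B) (h : Y ⟶ D) (k : Y ⟶ E) [Cocomm g h] :
    pair (pair f g) (pair h k) ≫ tensorμ A B D E = pair (pair f h) (pair g k) := by
  simp [tensorμ]

@[simp]
theorem pair_tensorμ_assoc (f : Y ⟶ A) (g : Y ⟶ B) (h : Y ⟶ D) (k : Y ⟶ E) [Cocomm g h] {W : C}
    (r : (A ⊗ D) ⊗ B ⊗ E ⟶ W) :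
    pair (pair f g) (pair h k) ≫ tensorμ A B D E ≫ r =
      pair (pair f h) (pair g k) ≫ r := by
  rw [← Category.assoc, pair_tensorμ]

variable [ComonObj A] [ComonObj B] [ComonObj D] [ComonObj E]

theorem comul_tensor : Δ[A ⊗ B] = (Δ[A] ⊗ₘ Δ[B]) ≫ tensorμ A A B B :=
  Comon.tensorObj_comul A B

theorem counit_tensor : ε[A ⊗ B] = (ε[A] ⊗ₘ ε[B]) ≫ (λ_ (𝟙_ C)).hom :=
  Comon.tensorObj_counit A B

theorem pair_fst_snd : pair (fst A B) (snd A B) = 𝟙 (A ⊗ B) := by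
  have : (fst A B ⊗ₘ snd A B) = ((𝟙 A ⊗ₘ ε[B]) ⊗ₘ (ε[A] ⊗ₘ 𝟙 B)) ≫
      ((ρ_ A).hom ⊗ₘ (λ_ B).hom) := by simp [fst, snd]
  rw [pair, comul_tensor, this, Category.assoc, ← tensorμ_natural_assoc,
    tensorHom_comp_tensorHom_assoc, ComonObj.comul_counit_hom, ComonObj.counit_comul_hom]
  -- the two middle factors have become the unit object, where the braiding is trivial
  simp only [tensorμ, braiding_tensorUnit_left]
  monoidal

theorem pair_snd_fst : pair (snd A B) (fst A B) = (β_ A B).hom := by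
  have : (snd A B ⊗ₘ fst A B) = ((ε[A] ⊗ₘ 𝟙 B) ⊗ₘ (𝟙 A ⊗ₘ ε[B])) ≫
      ((λ_ B).hom ⊗ₘ (ρ_ A).hom) := by simp [fst, snd]
  rw [pair, comul_tensor, this, Category.assoc, ← tensorμ_natural_assoc,
    tensorHom_comp_tensorHom_assoc, ComonObj.comul_counit_hom, ComonObj.counit_comul_hom]
  simp [tensorμ]
  monoidal

theorem tensorHom_eq_pair {A' B' : C} (f : A ⟶ A') (g : B ⟶ B') :
    (f ⊗ₘ g) = pair (fst A B ≫ f) (snd A B ≫ g) := by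
  rw [← pair_tensorHom, pair_fst_snd, Category.id_comp]

/-- A comonoid morphism into `A ⊗ B` is the pairing of its two components. -/
theorem eq_pair (a : Y ⟶ A ⊗ B) [IsComonHom a] :
    pair (a ≫ fst A B) (a ≫ snd A B) = a := by
  rw [← comp_pair, pair_fst_snd, Category.comp_id]

instance : IsComonHom (fst A B) where
  hom_counit := by
    rw [counit_tensor, unitors_equal, tensorHom_def', Category.assoc, rightUnitor_naturality, fst,
      Category.assoc]
  hom_comul := by
    have : (fst A B ⊗ₘ fst A B) = ((𝟙 A ⊗ₘ ε[B]) ⊗ₘ (𝟙 A ⊗ₘ ε[B])) ≫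
        ((ρ_ A).hom ⊗ₘ (ρ_ A).hom) := by simp [fst]
    rw [comul_tensor, this, Category.assoc, ← tensorμ_natural_assoc,
      tensorHom_comp_tensorHom_assoc, ComonObj.counit_comul_hom, id_tensorHom_id, Category.comp_id,
      fst, Category.assoc, ← rightUnitor_naturality, tensor_right_unitality]
    simp only [tensorHom_def', MonoidalCategory.whiskerLeft_comp, Category.assoc,
      whisker_exchange_assoc]

instance : IsComonHom (snd A B) where
  hom_counit := by
    rw [counit_tensor, MonoidalCategory.tensorHom_def, Category.assoc, leftUnitor_naturality, snd,
      Category.assoc]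
  hom_comul := by
    have : (snd A B ⊗ₘ snd A B) = ((ε[A] ⊗ₘ 𝟙 B) ⊗ₘ (ε[A] ⊗ₘ 𝟙 B)) ≫
        ((λ_ B).hom ⊗ₘ (λ_ B).hom) := by simp [snd]
    rw [comul_tensor, this, Category.assoc, ← tensorμ_natural_assoc,
      tensorHom_comp_tensorHom_assoc, ComonObj.counit_comul_hom, id_tensorHom_id, Category.comp_id,
      snd, Category.assoc, ← leftUnitor_naturality, tensor_left_unitality]
    simp only [MonoidalCategory.tensorHom_def, comp_whiskerRight, Category.assoc,
      ← whisker_exchange_assoc]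

instance : Cocomm (fst A B) (snd A B) where
  pair_braiding := by rw [pair_fst_snd, pair_snd_fst, Category.id_comp]

instance Cocomm.comp_left (f : Y ⟶ A) (g : Y ⟶ B) (a : A ⟶ D) [Cocomm f g] :
    Cocomm (f ≫ a) g where
  pair_braiding := by
    rw [← pair_whiskerRight, Category.assoc, BraidedCategory.braiding_naturality_left,
      Cocomm.pair_braiding_assoc, pair_whiskerLeft]

instance Cocomm.precomp (q : Z ⟶ Y) [IsComonHom q] (f : Y ⟶ A) (g : Y ⟶ B) [Cocomm f g] :
    Cocomm (q ≫ f) (q ≫ g) where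
  pair_braiding := by simp [← comp_pair]

instance Cocomm.pair_right (f : Y ⟶ A) (g : Y ⟶ B) (h : Y ⟶ D) [Cocomm f g] [Cocomm f h] :
    Cocomm f (pair g h) where
  pair_braiding := by simp

instance isComonHom_pair (f : Y ⟶ A) (g : Y ⟶ B) [IsComonHom f] [IsComonHom g] [Cocomm f g] :
    IsComonHom (pair f g) where
  hom_counit := by simp
  hom_comul := by
    rw [comul_tensor, pair_tensorHom_assoc, comp_comul, comp_comul, pair_tensorμ]
    rfl

end

/-! ### Extensionality for morphisms out of tensor products of comonoids -/

section Symmetric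

variable {C : Type u} [Category.{v} C] [MonoidalCategory C] [SymmetricCategory C]
variable {Y A B : C} [ComonObj Y]

instance Cocomm.symm (f : Y ⟶ A) (g : Y ⟶ B) [Cocomm f g] : Cocomm g f where
  pair_braiding := by
    rw [← Cocomm.pair_braiding (f := f) (g := g), Category.assoc, SymmetricCategory.symmetry,
      Category.comp_id]

/-- In Sweedler notation, `f y₃ ⊗ f y₁ ⊗ g y₂ = f y₂ ⊗ f y₁ ⊗ g y₃`. Only `g` and `f` are
interchanged; the two copies of `f` keep their order. -/
theorem pair_pair_braiding (f : Y ⟶ A) (g : Y ⟶ B) [Cocomm f g] :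
    pair (pair f g) f ≫ (β_ (A ⊗ B) A).hom =
      pair (pair f f) g ≫ (β_ A A).hom ▷ B ≫ (α_ A A B).hom := by
  have h : pair (pair f g) f = pair (pair f f) g ≫ (α_ A A B).hom ≫ A ◁ (β_ A B).hom ≫
      (α_ A B A).inv := by simp
  rw [h]
  simp [BraidedCategory.braiding_tensor_left_hom]

variable {D E Z : C} [ComonObj A] [ComonObj B] [ComonObj D] [ComonObj E]

/-- Morphisms out of `A ⊗ B` that agree on all pairings of interchangeable comonoid morphisms are
equal, since the identity of `A ⊗ B` is such a pairing. -/
theorem tensor_ext {f g : A ⊗ B ⟶ Z}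
    (h : ∀ (Y : C) [ComonObj Y] (a : Y ⟶ A) (b : Y ⟶ B) [IsComonHom a] [IsComonHom b]
      [Cocomm a b], pair a b ≫ f = pair a b ≫ g) : f = g := by
  simpa [pair_fst_snd] using h (A ⊗ B) (fst A B) (snd A B)

theorem tensor_ext₃ {f g : (A ⊗ B) ⊗ D ⟶ Z}
    (h : ∀ (Y : C) [ComonObj Y] (a : Y ⟶ A) (b : Y ⟶ B) (d : Y ⟶ D) [IsComonHom a]
      [IsComonHom b] [IsComonHom d] [Cocomm a b] [Cocomm a d] [Cocomm b d],
      pair (pair a b) d ≫ f = pair (pair a b) d ≫ g) : f = g := by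
  have := h ((A ⊗ B) ⊗ D) (fst _ _ ≫ fst _ _) (fst _ _ ≫ snd _ _) (snd _ _)
  simpa [pair_fst_snd, ← comp_pair] using this

theorem tensor_ext₄ {f g : (A ⊗ B) ⊗ (D ⊗ E) ⟶ Z}
    (h : ∀ (Y : C) [ComonObj Y] (a : Y ⟶ A) (b : Y ⟶ B) (d : Y ⟶ D) (e : Y ⟶ E) [IsComonHom a]
      [IsComonHom b] [IsComonHom d] [IsComonHom e] [Cocomm a b] [Cocomm a d] [Cocomm a e]
      [Cocomm b d] [Cocomm b e] [Cocomm d e],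
      pair (pair a b) (pair d e) ≫ f = pair (pair a b) (pair d e) ≫ g) : f = g := by
  have := h ((A ⊗ B) ⊗ (D ⊗ E)) (fst _ _ ≫ fst _ _) (fst _ _ ≫ snd _ _) (snd _ _ ≫ fst _ _)
    (snd _ _ ≫ snd _ _)
  simpa [pair_fst_snd, ← comp_pair] using this

end Symmetric

section

variable {C : Type u} [Category.{v} C] [MonoidalCategory C] [SymmetricCategory C]
variable {Y : C} [ComonObj Y]

/-! ### Bialgebras -/

namespace BiAlg

variable (A : BiAlg C)

instance : IsComonHom A.mul where
  hom_counit := A.isBialgebra.mul_counit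
  hom_comul := by rw [A.isBialgebra.mul_comul, comul_tensor, Category.assoc]

instance : IsComonHom (ε[Y] ≫ A.one) where
  hom_counit := by simp [A.isBialgebra.one_counit]
  hom_comul := by
    rw [Category.assoc, A.isBialgebra.one_comul, ← tensorHom_comp_tensorHom,
      ComonObj.counit_comul_hom_assoc, leftUnitor_inv_naturality_assoc]

@[simp]
theorem pair_one_mul (a : Y ⟶ A.obj) : pair (ε[Y] ≫ A.one) a ≫ A.mul = a := by
  rw [← pair_whiskerRight, Category.assoc, A.isBialgebra.one_mul, pair_counit_left]

theorem pair_one_mul_assoc (a : Y ⟶ A.obj) {W : C} (k : A.obj ⟶ W) :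
    pair (ε[Y] ≫ A.one) a ≫ A.mul ≫ k = a ≫ k := by
  rw [← Category.assoc, pair_one_mul]

@[simp]
theorem pair_mul_one (a : Y ⟶ A.obj) : pair a (ε[Y] ≫ A.one) ≫ A.mul = a := by
  rw [← pair_whiskerLeft, Category.assoc, A.isBialgebra.mul_one, pair_counit_right]

theorem pair_mul_one_assoc (a : Y ⟶ A.obj) {W : C} (k : A.obj ⟶ W) :
    pair a (ε[Y] ≫ A.one) ≫ A.mul ≫ k = a ≫ k := by
  rw [← Category.assoc, pair_mul_one]

end BiAlg

theorem IsBialgHom.pair_mul {A B : BiAlg C} {f : A.obj ⟶ B.obj} (hf : IsBialgHom A B f)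
    (a a' : Y ⟶ A.obj) : pair a a' ≫ A.mul ≫ f = pair (a ≫ f) (a' ≫ f) ≫ B.mul := by
  rw [hf.mul_hom, pair_tensorHom_assoc]

theorem IsBialgHom.of_pair {A B : BiAlg C} {f : A.obj ⟶ B.obj} [IsComonHom f]
    (h₁ : A.one ≫ f = B.one)
    (h : ∀ (Y : C) [ComonObj Y] (a a' : Y ⟶ A.obj) [IsComonHom a] [IsComonHom a'] [Cocomm a a'],
      pair a a' ≫ A.mul ≫ f = pair (a ≫ f) (a' ≫ f) ≫ B.mul) : IsBialgHom A B f where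
  one_hom := h₁
  mul_hom := tensor_ext fun Y _ a a' _ _ _ ↦ by rw [h, pair_tensorHom_assoc]
  isComonHom := inferInstance

/-! ### The semidirect product -/

namespace Act

variable (T : Act C)

instance : IsComonHom T.act where
  hom_counit := T.isAction.act_counit
  hom_comul := by rw [T.isAction.act_comul, comul_tensor, Category.assoc]

@[simp]
theorem pair_one_act (x : Y ⟶ T.X.obj) : pair (ε[Y] ≫ T.B.one) x ≫ T.act = x := by
  rw [← pair_whiskerRight, Category.assoc, T.isAction.one_act, pair_counit_left]

@[simp]
theorem pair_act_one (b : Y ⟶ T.B.obj) [IsComonHom b] :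
    pair b (ε[Y] ≫ T.X.one) ≫ T.act = ε[Y] ≫ T.X.one := by
  rw [← pair_whiskerLeft, Category.assoc, T.isAction.act_one, pair_counit_right_assoc,
    IsComonHom.hom_counit_assoc]

/-- The cocommutativity axiom of an action, on generalized elements:
`b₁ ⊗ (b₂ ▷ x) = b₂ ⊗ (b₁ ▷ x)`. -/
instance cocomm_act (b : Y ⟶ T.B.obj) (x : Y ⟶ T.X.obj) [IsComonHom b] [Cocomm b x] :
    Cocomm b (pair b x ≫ T.act) where
  pair_braiding := by
    rw [← cancel_mono (β_ _ _).hom, Category.assoc, SymmetricCategory.symmetry, Category.comp_id,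
      ← pair_whiskerRight, Category.assoc, BraidedCategory.braiding_naturality_left,
      ← Category.assoc, pair_pair_braiding]
    have := pair b x ≫= T.isAction.comul_act
    rw [pair_whiskerRight_assoc, comp_comul, pair_whiskerRight_assoc, comp_comul] at this
    simpa using this

/-- The multiplication of the semidirect product on generalized elements:
`(x, b) (x', b') = (x (b ▷ x'), b b')`. -/
@[simp]
theorem pair_sdMul (x x' : Y ⟶ T.X.obj) (b b' : Y ⟶ T.B.obj) [IsComonHom b] [Cocomm b x'] :
    pair (pair x b) (pair x' b') ≫ T.sdMul =
      pair (pair x (pair b x' ≫ T.act) ≫ T.X.mul) (pair b b' ≫ T.B.mul) := by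
  rw [sdMul, pair_whiskerRight_assoc, pair_whiskerLeft_assoc, comp_comul]
  simp

theorem pair_sdMul_assoc (x x' : Y ⟶ T.X.obj) (b b' : Y ⟶ T.B.obj) [IsComonHom b] [Cocomm b x']
    {W : C} (k : T.X.obj ⊗ T.B.obj ⟶ W) :
    pair (pair x b) (pair x' b') ≫ T.sdMul ≫ k =
      pair (pair x (pair b x' ≫ T.act) ≫ T.X.mul) (pair b b' ≫ T.B.mul) ≫ k := by
  rw [← Category.assoc, pair_sdMul]

theorem counit_sdOne : ε[Y] ≫ T.sdOne = pair (ε[Y] ≫ T.X.one) (ε[Y] ≫ T.B.one) := by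
  rw [sdOne, ← pair_tensorHom, pair, ComonObj.counit_comul_hom, Category.assoc]

@[simp]
theorem comp_i₁ (x : Y ⟶ T.X.obj) [IsComonHom x] : x ≫ T.i₁ = pair x (ε[Y] ≫ T.B.one) := by
  rw [i₁, ← pair_whiskerLeft, pair, ComonObj.comul_counit_hom]
  simp

@[simp]
theorem comp_i₂ (b : Y ⟶ T.B.obj) [IsComonHom b] : b ≫ T.i₂ = pair (ε[Y] ≫ T.X.one) b := by
  rw [i₂, ← pair_whiskerRight, pair, ComonObj.counit_comul_hom]
  simp

theorem i₁_eq : T.i₁ = pair (𝟙 _) (ε ≫ T.B.one) := by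
  rw [← comp_i₁, Category.id_comp]

theorem i₂_eq : T.i₂ = pair (ε ≫ T.X.one) (𝟙 _) := by
  rw [← comp_i₂, Category.id_comp]

theorem π₁_eq : T.π₁ = fst _ _ := rfl

theorem π₂_eq : T.π₂ = snd _ _ := rfl

instance : IsComonHom T.i₁ := by rw [i₁_eq]; infer_instance

instance : IsComonHom T.i₂ := by rw [i₂_eq]; infer_instance

/-- The element `(x (b ▷ x'), b b')` is a comonoid morphism: its entries are interchangeable, since
both `b` and `b'` are interchangeable with `x` and with `b ▷ x'`. -/
theorem isComonHom_pair_sdMul (x x' : Y ⟶ T.X.obj) (b b' : Y ⟶ T.B.obj) [IsComonHom x]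
    [IsComonHom b] [IsComonHom x'] [IsComonHom b'] [Cocomm x b] [Cocomm x x'] [Cocomm x b']
    [Cocomm b x'] [Cocomm b b'] [Cocomm x' b'] :
    IsComonHom (pair (pair x (pair b x' ≫ T.act) ≫ T.X.mul) (pair b b' ≫ T.B.mul)) :=
  inferInstance

instance : IsComonHom T.sdMul := by
  have h : T.sdMul = pair (pair (fst _ _ ≫ fst _ _) (fst _ _ ≫ snd _ _))
      (pair (snd _ _ ≫ fst _ _) (snd _ _ ≫ snd _ _)) ≫ T.sdMul := by
    simp [pair_fst_snd, ← comp_pair, -pair_sdMul]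
  rw [h, pair_sdMul]
  exact T.isComonHom_pair_sdMul _ _ _ _

attribute [local instance] ComonObj.instTensorUnit in
theorem isComonHom_sdOne : IsComonHom T.sdOne := by
  have h : T.sdOne = pair (ε[𝟙_ C] ≫ T.X.one) (ε[𝟙_ C] ≫ T.B.one) := by
    rw [← counit_sdOne]
    simp
  rw [h]
  infer_instance

theorem isBialgebra_sd : IsBialgebra (T.X.obj ⊗ T.B.obj) T.sdOne T.sdMul where
  one_mul := by
    rw [← cancel_epi (λ_ _).inv, Iso.inv_hom_id, leftUnitor_inv_eq_pair, pair_whiskerRight_assoc,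
      counit_sdOne, ← pair_fst_snd, pair_sdMul, T.pair_one_act, T.X.pair_one_mul, T.B.pair_one_mul]
  mul_one := by
    rw [← cancel_epi (ρ_ _).inv, Iso.inv_hom_id, rightUnitor_inv_eq_pair, pair_whiskerLeft_assoc,
      counit_sdOne, ← pair_fst_snd, pair_sdMul, T.pair_act_one, T.X.pair_mul_one, T.B.pair_mul_one]
  mul_comul := by rw [IsComonHom.hom_comul, comul_tensor, Category.assoc]
  one_comul := by
    let := ComonObj.instTensorUnit C
    have := T.isComonHom_sdOne
    exact IsComonHom.hom_comul T.sdOne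
  mul_counit := IsComonHom.hom_counit T.sdMul
  one_counit := by
    let := ComonObj.instTensorUnit C
    have := T.isComonHom_sdOne
    exact IsComonHom.hom_counit T.sdOne

end Act

/-! ### The split extension attached to an action -/

/-- The axioms of a split extension, checked on generalized elements. The morphism `act` stands for
the induced action, so that the cocommutativity axiom takes the form it has for actions. -/
theorem IsSplitExtension.of_pair {X A B : BiAlg C} {κ : X.obj ⟶ A.obj} {α : A.obj ⟶ B.obj}
    {e : B.obj ⟶ A.obj} {l : A.obj ⟶ X.obj} {act : B.obj ⊗ X.obj ⟶ X.obj}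
    (hκ : IsBialgHom X A κ) (hα : IsBialgHom A B α) (he : IsBialgHom B A e) (hl : IsComonHom l)
    (one_l : A.one ≫ l = X.one) (κ_l : κ ≫ l = 𝟙 X.obj) (e_α : e ≫ α = 𝟙 B.obj)
    (e_l : e ≫ l = ε[B.obj] ≫ X.one) (κ_α : κ ≫ α = ε[X.obj] ≫ B.one)
    (decomp : pair (l ≫ κ) (α ≫ e) ≫ A.mul = 𝟙 A.obj)
    (mul_l : ∀ (Y : C) [ComonObj Y] (x : Y ⟶ X.obj) (b : Y ⟶ B.obj) [IsComonHom x] [IsComonHom b]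
      [Cocomm x b], pair (x ≫ κ) (b ≫ e) ≫ A.mul ≫ l = x)
    (act_eq : (e ⊗ₘ κ) ≫ A.mul ≫ l = act)
    (comul_act : Δ[B.obj] ▷ X.obj ≫ (α_ B.obj B.obj X.obj).hom ≫ B.obj ◁ act =
      Δ[B.obj] ▷ X.obj ≫ (β_ B.obj B.obj).hom ▷ X.obj ≫ (α_ B.obj B.obj X.obj).hom ≫ B.obj ◁ act)
    (assoc_κ_e_id : ∀ (Y : C) [ComonObj Y] (x : Y ⟶ X.obj) (b : Y ⟶ B.obj) (a : Y ⟶ A.obj)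
      [IsComonHom x] [IsComonHom b] [IsComonHom a] [Cocomm x b] [Cocomm x a] [Cocomm b a],
      pair (pair (x ≫ κ) (b ≫ e) ≫ A.mul) a ≫ A.mul =
        pair (x ≫ κ) (pair (b ≫ e) a ≫ A.mul) ≫ A.mul)
    (assoc_κ_id_e : ∀ (Y : C) [ComonObj Y] (x : Y ⟶ X.obj) (a : Y ⟶ A.obj) (b : Y ⟶ B.obj)
      [IsComonHom x] [IsComonHom a] [IsComonHom b] [Cocomm x a] [Cocomm x b] [Cocomm a b],
      pair (pair (x ≫ κ) a ≫ A.mul) (b ≫ e) ≫ A.mul =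
        pair (x ≫ κ) (pair a (b ≫ e) ≫ A.mul) ≫ A.mul)
    (assoc_id_κ_e : ∀ (Y : C) [ComonObj Y] (a : Y ⟶ A.obj) (x : Y ⟶ X.obj) (b : Y ⟶ B.obj)
      [IsComonHom a] [IsComonHom x] [IsComonHom b] [Cocomm a x] [Cocomm a b] [Cocomm x b],
      pair (pair a (x ≫ κ) ≫ A.mul) (b ≫ e) ≫ A.mul =
        pair a (pair (x ≫ κ) (b ≫ e) ≫ A.mul) ≫ A.mul) :
    IsSplitExtension X A B κ α e l where
  isBialgHom_κ := hκ
  isBialgHom_α := hα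
  isBialgHom_e := he
  κ_l := κ_l
  e_α := e_α
  e_l := e_l
  κ_α := κ_α
  decomp := by rw [← decomp, pair, Category.assoc]
  mul_l := tensor_ext fun Y _ x b _ _ _ ↦ by simp [mul_l]
  comul_mul := by
    simp only [← MonoidalCategory.whiskerLeft_comp, act_eq]
    exact comul_act
  assoc_κ_e_id := tensor_ext₃ fun Y _ x b a _ _ _ _ _ _ ↦ by simp [assoc_κ_e_id]
  assoc_κ_id_e := tensor_ext₃ fun Y _ x a b _ _ _ _ _ _ ↦ by simp [assoc_κ_id_e]
  assoc_id_κ_e := tensor_ext₃ fun Y _ a x b _ _ _ _ _ _ ↦ by simp [assoc_id_κ_e]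
  isComonHom_l := hl
  one_l := one_l

namespace Act

variable (T : Act C)

theorem one_i₁ : T.X.one ≫ T.i₁ = T.sdOne := by
  simp only [i₁, sdOne, tensorHom_def', rightUnitor_inv_naturality_assoc, unitors_inv_equal,
    whisker_exchange]

theorem one_i₂ : T.B.one ≫ T.i₂ = T.sdOne := by
  simp only [i₂, sdOne, tensorHom_def', leftUnitor_inv_naturality_assoc]

theorem sdOne_π₁ : T.sdOne ≫ T.π₁ = T.X.one := by
  rw [← one_i₂, Category.assoc, i₂_eq, π₁_eq, pair_fst, ← Category.assoc,
    T.B.isBialgebra.one_counit, Category.id_comp]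

theorem sdOne_π₂ : T.sdOne ≫ T.π₂ = T.B.one := by
  rw [← one_i₁, Category.assoc, i₁_eq, π₂_eq, pair_snd, ← Category.assoc,
    T.X.isBialgebra.one_counit, Category.id_comp]

theorem isBialgHom_i₁ : IsBialgHom T.X (T.sd T.isBialgebra_sd) T.i₁ :=
  haveI : IsComonHom (N := (T.sd T.isBialgebra_sd).obj) T.i₁ := inferInstanceAs (IsComonHom T.i₁)
  .of_pair T.one_i₁ fun Y _ x x' _ _ _ ↦ by
    change pair x x' ≫ T.X.mul ≫ T.i₁ = pair (x ≫ T.i₁) (x' ≫ T.i₁) ≫ T.sdMul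
    rw [← Category.assoc, comp_i₁, comp_i₁, comp_i₁, pair_sdMul]
    simp

theorem isBialgHom_i₂ : IsBialgHom T.B (T.sd T.isBialgebra_sd) T.i₂ :=
  haveI : IsComonHom (N := (T.sd T.isBialgebra_sd).obj) T.i₂ := inferInstanceAs (IsComonHom T.i₂)
  .of_pair T.one_i₂ fun Y _ b b' _ _ _ ↦ by
    change pair b b' ≫ T.B.mul ≫ T.i₂ = pair (b ≫ T.i₂) (b' ≫ T.i₂) ≫ T.sdMul
    rw [← Category.assoc, comp_i₂, comp_i₂, comp_i₂, pair_sdMul]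
    simp

/-- A comonoid morphism out of the semidirect product is a morphism of bialgebras if it is unital
and multiplicative on generalized elements. -/
theorem isBialgHom_sd_of_pair {A : BiAlg C} {f : T.X.obj ⊗ T.B.obj ⟶ A.obj} (hf : IsComonHom f)
    (h₁ : T.sdOne ≫ f = A.one)
    (h : ∀ (Y : C) [ComonObj Y] (x : Y ⟶ T.X.obj) (b : Y ⟶ T.B.obj) (x' : Y ⟶ T.X.obj)
      (b' : Y ⟶ T.B.obj) [IsComonHom x] [IsComonHom b] [IsComonHom x'] [IsComonHom b'] [Cocomm x b]
      [Cocomm x x'] [Cocomm x b'] [Cocomm b x'] [Cocomm b b'] [Cocomm x' b'],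
      pair (pair x (pair b x' ≫ T.act) ≫ T.X.mul) (pair b b' ≫ T.B.mul) ≫ f =
        pair (pair x b ≫ f) (pair x' b' ≫ f) ≫ A.mul) :
    IsBialgHom (T.sd T.isBialgebra_sd) A f where
  one_hom := h₁
  mul_hom := by
    have : T.sdMul ≫ f = (f ⊗ₘ f) ≫ A.mul :=
      tensor_ext₄ fun Y _ x b x' b' _ _ _ _ _ _ _ _ _ _ ↦ by
        rw [pair_sdMul_assoc, h, pair_tensorHom_assoc]
    exact this
  isComonHom := hf

theorem isBialgHom_π₂ : IsBialgHom (T.sd T.isBialgebra_sd) T.B T.π₂ :=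
  T.isBialgHom_sd_of_pair (inferInstanceAs (IsComonHom (snd T.X.obj T.B.obj))) T.sdOne_π₂
    fun Y _ x b x' b' _ _ _ _ _ _ _ _ _ _ ↦ by simp [π₂_eq]

/-- The action induced by the semidirect product split extension is the original action. -/
theorem tensorHom_sdMul_π₁ : (T.i₂ ⊗ₘ T.i₁) ≫ T.sdMul ≫ T.π₁ = T.act :=
  tensor_ext fun Y _ b x _ _ _ ↦ by
    rw [pair_tensorHom_assoc, comp_i₁, comp_i₂, pair_sdMul_assoc]
    simp [π₁_eq]

theorem isSplitExtension_sd :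
    IsSplitExtension T.X (T.sd T.isBialgebra_sd) T.B T.i₁ T.π₂ T.i₂ T.π₁ := by
  refine .of_pair T.isBialgHom_i₁ T.isBialgHom_π₂ T.isBialgHom_i₂
    (inferInstanceAs (IsComonHom (fst T.X.obj T.B.obj))) T.sdOne_π₁ ?_ ?_ ?_ ?_ ?_
    (fun Y _ x b _ _ _ ↦ ?_) T.tensorHom_sdMul_π₁ T.isAction.comul_act
    (fun Y _ x b a _ _ ha _ hxa hba ↦ ?_) (fun Y _ x a b _ ha _ hxa _ hab ↦ ?_)
    (fun Y _ a x b ha _ _ hax hab _ ↦ ?_)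
  · change T.i₁ ≫ T.π₁ = _
    simp [i₁_eq, π₁_eq]
  · change T.i₂ ≫ T.π₂ = _
    simp [i₂_eq, π₂_eq]
  · change T.i₂ ≫ T.π₁ = _
    simp [i₂_eq, π₁_eq]
  · change T.i₁ ≫ T.π₂ = _
    simp [i₁_eq, π₂_eq]
  · change pair (T.π₁ ≫ T.i₁) (T.π₂ ≫ T.i₂) ≫ T.sdMul = 𝟙 (T.X.obj ⊗ T.B.obj)
    rw [π₁_eq, π₂_eq, comp_i₁, comp_i₂, pair_sdMul, ← pair_fst_snd]
    simp [-Comon.tensorObj_counit]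
  · change pair (x ≫ T.i₁) (b ≫ T.i₂) ≫ T.sdMul ≫ T.π₁ = x
    rw [comp_i₁, comp_i₂, pair_sdMul_assoc]
    simp [π₁_eq]
  · change Y ⟶ T.X.obj ⊗ T.B.obj at a
    change IsComonHom a at ha
    change Cocomm x a at hxa
    change Cocomm b a at hba
    change pair (pair (x ≫ T.i₁) (b ≫ T.i₂) ≫ T.sdMul) a ≫ T.sdMul =
      pair (x ≫ T.i₁) (pair (b ≫ T.i₂) a ≫ T.sdMul) ≫ T.sdMul
    rw [comp_i₁, comp_i₂, ← eq_pair a]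
    simp
  · change Y ⟶ T.X.obj ⊗ T.B.obj at a
    change IsComonHom a at ha
    change Cocomm x a at hxa
    change Cocomm a b at hab
    change pair (pair (x ≫ T.i₁) a ≫ T.sdMul) (b ≫ T.i₂) ≫ T.sdMul =
      pair (x ≫ T.i₁) (pair a (b ≫ T.i₂) ≫ T.sdMul) ≫ T.sdMul
    rw [comp_i₁, comp_i₂, ← eq_pair a]
    simp
  · change Y ⟶ T.X.obj ⊗ T.B.obj at a
    change IsComonHom a at ha
    change Cocomm a x at hax
    change Cocomm a b at hab
    change pair (pair a (x ≫ T.i₁) ≫ T.sdMul) (b ≫ T.i₂) ≫ T.sdMul =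
      pair a (pair (x ≫ T.i₁) (b ≫ T.i₂) ≫ T.sdMul) ≫ T.sdMul
    rw [comp_i₁, comp_i₂, ← eq_pair a]
    simp

theorem isSplitExtHom_sd {T T' : Act C} (f : T ⟶ T') :
    IsSplitExtHom (T.sdSplitExt T.isBialgebra_sd T.isSplitExtension_sd)
      (T'.sdSplitExt T'.isBialgebra_sd T'.isSplitExtension_sd) f.g f.v (f.v ⊗ₘ f.g) := by
  have hg := f.isActionHom.isBialgHom_g
  have hv := f.isActionHom.isBialgHom_v
  have := hg.isComonHom
  have := hv.isComonHom
  have hg₁ : T.B.one ≫ f.g = T'.B.one := hg.one_hom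
  have hv₁ : T.X.one ≫ f.v = T'.X.one := hv.one_hom
  refine ⟨hg, hv, ?_, ?_, ?_, ?_, ?_⟩
  · have hc : IsComonHom (f.v ⊗ₘ f.g) := by rw [tensorHom_eq_pair]; infer_instance
    refine T.isBialgHom_sd_of_pair (A := T'.sd T'.isBialgebra_sd) hc ?_
      fun Y _ x b x' b' _ _ _ _ _ _ _ _ _ _ ↦ ?_
    · change T.sdOne ≫ (f.v ⊗ₘ f.g) = T'.sdOne
      simp [sdOne, hg₁, hv₁]
    · change _ ≫ (f.v ⊗ₘ f.g) =
        pair (pair x b ≫ (f.v ⊗ₘ f.g)) (pair x' b' ≫ (f.v ⊗ₘ f.g)) ≫ T'.sdMul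
      have hact : pair b x' ≫ T.act ≫ f.v = pair (b ≫ f.g) (x' ≫ f.v) ≫ T'.act := by
        rw [f.isActionHom.act_comp, pair_tensorHom_assoc]
      simp [hg.pair_mul, hv.pair_mul, hact]
  · change T.i₁ ≫ (f.v ⊗ₘ f.g) = f.v ≫ T'.i₁
    simp [i₁_eq T, hg₁]
  · change T.π₂ ≫ f.g = (f.v ⊗ₘ f.g) ≫ T'.π₂
    rw [π₂_eq, π₂_eq, tensorHom_eq_pair, pair_snd]
  · change T.i₂ ≫ (f.v ⊗ₘ f.g) = f.g ≫ T'.i₂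
    simp [i₂_eq T, hv₁]
  · change T.π₁ ≫ f.v = (f.v ⊗ₘ f.g) ≫ T'.π₁
    rw [π₁_eq, π₁_eq, tensorHom_eq_pair, pair_fst]

end Act

/-! ### The action attached to a split extension -/

namespace SplitExt

variable (S : SplitExt C)

instance : IsComonHom S.κ := S.isSplitExtension.isBialgHom_κ.isComonHom

instance : IsComonHom S.e := S.isSplitExtension.isBialgHom_e.isComonHom

instance : IsComonHom S.l := S.isSplitExtension.isComonHom_l

instance : IsComonHom S.inducedAct := by
  rw [inducedAct, tensorHom_eq_pair]
  infer_instance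

theorem pair_inducedAct (b : Y ⟶ S.B.obj) (x : Y ⟶ S.X.obj) :
    pair b x ≫ S.inducedAct = pair (b ≫ S.e) (x ≫ S.κ) ≫ S.A.mul ≫ S.l := by
  rw [inducedAct, pair_tensorHom_assoc]

theorem isAction_inducedAct : IsAction S.B S.X S.inducedAct where
  one_act := by
    rw [← cancel_epi (λ_ _).inv, Iso.inv_hom_id, leftUnitor_inv_eq_pair, pair_whiskerRight_assoc,
      pair_inducedAct, Category.assoc, S.isSplitExtension.isBialgHom_e.one_hom, Category.id_comp,
      S.A.pair_one_mul_assoc, S.isSplitExtension.κ_l]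
  act_one := by
    rw [← cancel_epi (ρ_ _).inv, Iso.inv_hom_id_assoc, rightUnitor_inv_eq_pair,
      pair_whiskerLeft_assoc, pair_inducedAct, Category.assoc,
      S.isSplitExtension.isBialgHom_κ.one_hom, Category.id_comp, S.A.pair_mul_one_assoc, S.isSplitExtension.e_l]
  comul_act := by
    simpa only [inducedAct, MonoidalCategory.whiskerLeft_comp] using S.isSplitExtension.comul_mul
  act_counit := IsComonHom.hom_counit S.inducedAct
  act_comul := by rw [IsComonHom.hom_comul, comul_tensor, Category.assoc]

theorem isActionHom_inducedAct {S S' : SplitExt C} (f : S ⟶ S') :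
    IsActionHom S.inducedAct S'.inducedAct f.g f.v where
  isBialgHom_g := f.isSplitExtHom.isBialgHom_g
  isBialgHom_v := f.isSplitExtHom.isBialgHom_v
  act_comp := by
    simp only [inducedAct, Category.assoc, f.isSplitExtHom.l_comp]
    rw [← Category.assoc S.A.mul, f.isSplitExtHom.isBialgHom_p.mul_hom, Category.assoc,
      tensorHom_comp_tensorHom_assoc, tensorHom_comp_tensorHom_assoc, f.isSplitExtHom.e_comp,
      f.isSplitExtHom.κ_comp]

/-- Every element decomposes as `a = κ (l a₁) * e (α a₂)`. -/
theorem pair_decomp (a : Y ⟶ S.A.obj) [IsComonHom a] :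
    pair (a ≫ S.l ≫ S.κ) (a ≫ S.α ≫ S.e) ≫ S.A.mul = a := by
  rw [← comp_pair_assoc, pair, Category.assoc, S.isSplitExtension.decomp, Category.comp_id]

theorem pair_assoc_κ_e_id (x : Y ⟶ S.X.obj) (b : Y ⟶ S.B.obj) (a : Y ⟶ S.A.obj) :
    pair (pair (x ≫ S.κ) (b ≫ S.e) ≫ S.A.mul) a ≫ S.A.mul =
      pair (x ≫ S.κ) (pair (b ≫ S.e) a ≫ S.A.mul) ≫ S.A.mul := by
  simpa using pair (pair x b) a ≫= S.isSplitExtension.assoc_κ_e_id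

theorem pair_assoc_κ_id_e (x : Y ⟶ S.X.obj) (a : Y ⟶ S.A.obj) (b : Y ⟶ S.B.obj) :
    pair (pair (x ≫ S.κ) a ≫ S.A.mul) (b ≫ S.e) ≫ S.A.mul =
      pair (x ≫ S.κ) (pair a (b ≫ S.e) ≫ S.A.mul) ≫ S.A.mul := by
  simpa using pair (pair x a) b ≫= S.isSplitExtension.assoc_κ_id_e

theorem pair_assoc_id_κ_e (a : Y ⟶ S.A.obj) (x : Y ⟶ S.X.obj) (b : Y ⟶ S.B.obj) :
    pair (pair a (x ≫ S.κ) ≫ S.A.mul) (b ≫ S.e) ≫ S.A.mul =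
      pair a (pair (x ≫ S.κ) (b ≫ S.e) ≫ S.A.mul) ≫ S.A.mul := by
  simpa using pair (pair a x) b ≫= S.isSplitExtension.assoc_id_κ_e

theorem pair_mul_α (x : Y ⟶ S.X.obj) (b : Y ⟶ S.B.obj) [IsComonHom x] :
    pair (x ≫ S.κ) (b ≫ S.e) ≫ S.A.mul ≫ S.α = b := by
  rw [S.isSplitExtension.isBialgHom_α.pair_mul, Category.assoc, Category.assoc,
    S.isSplitExtension.κ_α, S.isSplitExtension.e_α, IsComonHom.hom_counit_assoc, Category.comp_id,
    S.B.pair_one_mul]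

/-- The commutation rule `e b * κ x = κ (b ▷ x) * e b`, obtained by decomposing `e b * κ x`. Its
image under `l` is `b ▷ x` and its image under `α` is `b`. -/
theorem pair_mul_of_e_κ (b : Y ⟶ S.B.obj) (x : Y ⟶ S.X.obj) [IsComonHom b] [IsComonHom x]
    [Cocomm b x] :
    pair (b ≫ S.e) (x ≫ S.κ) ≫ S.A.mul =
      pair ((pair b x ≫ S.inducedAct) ≫ S.κ) (b ≫ S.e) ≫ S.A.mul := by
  have h : pair (b ≫ S.e) (x ≫ S.κ) ≫ S.A.mul ≫ S.α = b := by
    rw [S.isSplitExtension.isBialgHom_α.pair_mul, Category.assoc, Category.assoc,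
      S.isSplitExtension.κ_α, S.isSplitExtension.e_α, IsComonHom.hom_counit_assoc, Category.comp_id,
      S.B.pair_mul_one]
  conv_lhs => rw [← S.pair_decomp (pair (b ≫ S.e) (x ≫ S.κ) ≫ S.A.mul)]
  simp only [← Category.assoc _ S.α, ← Category.assoc _ S.l]
  rw [Category.assoc _ _ S.l, Category.assoc _ _ S.α, h, pair_inducedAct]

/-- The product of `κ x * e b` and `κ x' * e b'` is `κ (x (b ▷ x')) * e (b b')`. -/
theorem pair_mul_mul (x x' : Y ⟶ S.X.obj) (b b' : Y ⟶ S.B.obj) [IsComonHom b] [IsComonHom x']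
    [Cocomm b x'] :
    pair (pair (x ≫ S.κ) (b ≫ S.e) ≫ S.A.mul) (pair (x' ≫ S.κ) (b' ≫ S.e) ≫ S.A.mul) ≫ S.A.mul =
      pair ((pair x (pair b x' ≫ S.inducedAct) ≫ S.X.mul) ≫ S.κ) ((pair b b' ≫ S.B.mul) ≫ S.e) ≫
        S.A.mul := by
  -- `(κ x * e b) * (κ x' * e b')` is rewritten as `κ x * ((e b * κ x') * e b')`, then as
  -- `κ x * ((κ (b ▷ x') * e b) * e b')`, then as `κ x * (κ (b ▷ x') * (e b * e b'))`
  rw [pair_assoc_κ_e_id, ← pair_assoc_id_κ_e, pair_mul_of_e_κ, pair_assoc_κ_e_id,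
    ← S.isSplitExtension.isBialgHom_e.pair_mul, ← Category.assoc (pair b b'), ← pair_assoc_κ_id_e,
    ← S.isSplitExtension.isBialgHom_κ.pair_mul, ← Category.assoc (pair x _)]

/-! ### The comparison with the semidirect product -/

/-- The object of `Act C` given by the action attached to a split extension. It is reducible, so
that its fields are recognized as those of `S`. -/
abbrev inducedActObj : Act C := ⟨S.B, S.X, S.inducedAct, S.isAction_inducedAct⟩

/-- The semidirect product split extension of the action attached to `S`. -/
def semidirect : SplitExt C :=
  S.inducedActObj.sdSplitExt S.inducedActObj.isBialgebra_sd S.inducedActObj.isSplitExtension_sd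

/-- The comparison morphism `(x, b) ↦ κ x * e b` from the semidirect product to the middle
object. -/
def fromSd : S.X.obj ⊗ S.B.obj ⟶ S.A.obj := (S.κ ⊗ₘ S.e) ≫ S.A.mul

theorem pair_fromSd (x : Y ⟶ S.X.obj) (b : Y ⟶ S.B.obj) :
    pair x b ≫ S.fromSd = pair (x ≫ S.κ) (b ≫ S.e) ≫ S.A.mul := by
  rw [fromSd, pair_tensorHom_assoc]

instance : IsComonHom S.fromSd := by
  rw [fromSd, tensorHom_eq_pair]
  infer_instance

theorem i₁_fromSd : S.inducedActObj.i₁ ≫ S.fromSd = S.κ := by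
  rw [Act.i₁_eq]
  refine (S.pair_fromSd _ _).trans ?_
  have h : S.inducedActObj.B.one ≫ S.e = S.A.one := S.isSplitExtension.isBialgHom_e.one_hom
  rw [Category.assoc, h]
  exact (S.A.pair_mul_one _).trans (Category.id_comp _)

theorem i₂_fromSd : S.inducedActObj.i₂ ≫ S.fromSd = S.e := by
  rw [Act.i₂_eq]
  refine (S.pair_fromSd _ _).trans ?_
  have h : S.inducedActObj.X.one ≫ S.κ = S.A.one := S.isSplitExtension.isBialgHom_κ.one_hom
  rw [Category.assoc, h]
  exact (S.A.pair_one_mul _).trans (Category.id_comp _)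

theorem fromSd_l : S.fromSd ≫ S.l = fst S.X.obj S.B.obj := by
  rw [fromSd, Category.assoc, S.isSplitExtension.mul_l, fst]

theorem fromSd_α : S.fromSd ≫ S.α = snd S.X.obj S.B.obj := by
  rw [fromSd, tensorHom_eq_pair, Category.assoc, pair_mul_α]

theorem isSplitExtHom_fromSd : IsSplitExtHom S.semidirect S (𝟙 S.B.obj) (𝟙 S.X.obj) S.fromSd where
  isBialgHom_g := .id _
  isBialgHom_v := .id _
  isBialgHom_p := by
    refine S.inducedActObj.isBialgHom_sd_of_pair (inferInstanceAs (IsComonHom S.fromSd)) ?_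
      fun Y _ x b x' b' _ _ _ _ _ _ _ _ _ _ ↦ ?_
    · rw [← Act.one_i₂, Category.assoc, i₂_fromSd]
      exact S.isSplitExtension.isBialgHom_e.one_hom
    · change pair (pair x (pair b x' ≫ S.inducedAct) ≫ S.X.mul) (pair b b' ≫ S.B.mul) ≫
        S.fromSd = _
      rw [pair_fromSd, pair_fromSd, pair_fromSd, pair_mul_mul]
  κ_comp := S.i₁_fromSd.trans (Category.id_comp _).symm
  α_comp := (Category.comp_id _).trans S.fromSd_α.symm
  e_comp := S.i₂_fromSd.trans (Category.id_comp _).symm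
  l_comp := (Category.comp_id _).trans S.fromSd_l.symm

/-- The comparison morphism is invertible, with inverse `a ↦ (l a₁, α a₂)`. -/
def fromSdIso : S.X.obj ⊗ S.B.obj ≅ S.A.obj where
  hom := S.fromSd
  inv := pair S.l S.α
  hom_inv_id := by rw [comp_pair, fromSd_l, fromSd_α, pair_fst_snd]
  inv_hom_id := by
    rw [pair_fromSd, pair, Category.assoc, S.isSplitExtension.decomp]

end SplitExt

/-! ### The equivalence -/

theorem IsBialgHom.inv {A B : BiAlg C} (f : A.obj ≅ B.obj) (h : IsBialgHom A B f.hom) :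
    IsBialgHom B A f.inv where
  one_hom := by rw [Iso.comp_inv_eq, h.one_hom]
  mul_hom := by
    rw [Iso.comp_inv_eq, Category.assoc, h.mul_hom, tensorHom_comp_tensorHom_assoc, f.inv_hom_id,
      id_tensorHom_id, Category.id_comp]
  isComonHom := by
    have := h.isComonHom
    infer_instance

/-- An isomorphism of split extensions from a morphism of split extensions whose three components
are invertible. -/
def SplitExt.isoMk {S S' : SplitExt C} (g : S.B.obj ≅ S'.B.obj) (v : S.X.obj ≅ S'.X.obj)
    (p : S.A.obj ≅ S'.A.obj) (h : IsSplitExtHom S S' g.hom v.hom p.hom) : S ≅ S' where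
  hom := ⟨g.hom, v.hom, p.hom, h⟩
  inv := ⟨g.inv, v.inv, p.inv,
    { isBialgHom_g := h.isBialgHom_g.inv
      isBialgHom_v := h.isBialgHom_v.inv
      isBialgHom_p := h.isBialgHom_p.inv
      κ_comp := by rw [Iso.comp_inv_eq, Category.assoc, h.κ_comp, Iso.inv_hom_id_assoc]
      α_comp := by rw [Iso.comp_inv_eq, Category.assoc, h.α_comp, Iso.inv_hom_id_assoc]
      e_comp := by rw [Iso.comp_inv_eq, Category.assoc, h.e_comp, Iso.inv_hom_id_assoc]
      l_comp := by rw [Iso.comp_inv_eq, Category.assoc, h.l_comp, Iso.inv_hom_id_assoc] }⟩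
  hom_inv_id := SplitExt.Hom.ext g.hom_inv_id v.hom_inv_id p.hom_inv_id
  inv_hom_id := SplitExt.Hom.ext g.inv_hom_id v.inv_hom_id p.inv_hom_id

variable (C) in
/-- The functor `F`, sending a split extension to its induced action. -/
def splitExtToAct : SplitExt C ⥤ Act C :=
  SplitExt.toAct SplitExt.isAction_inducedAct fun _ _ ↦ SplitExt.isActionHom_inducedAct

variable (C) in
/-- The functor `G`, sending an action to its semidirect product split extension. -/
def actToSplitExt : Act C ⥤ SplitExt C :=
  Act.toSplitExt Act.isBialgebra_sd Act.isSplitExtension_sd fun _ _ ↦ Act.isSplitExtHom_sd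

variable (C) in
/-- The natural isomorphism given by the comparison morphisms `X ⋊ B ⟶ A` (in the direction of a
unit, hence inverted). -/
def splitExtActUnitIso : 𝟭 (SplitExt C) ≅ splitExtToAct C ⋙ actToSplitExt C :=
  (NatIso.ofComponents
    (fun S ↦ SplitExt.isoMk (S := S.semidirect) (S' := S) (Iso.refl _) (Iso.refl _) S.fromSdIso
      S.isSplitExtHom_fromSd)
    fun {S S'} f ↦ by
      refine SplitExt.Hom.ext ((Category.comp_id _).trans (Category.id_comp _).symm)
        ((Category.comp_id _).trans (Category.id_comp _).symm) ?_
      change (f.v ⊗ₘ f.g) ≫ S'.fromSd = S.fromSd ≫ f.p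
      rw [SplitExt.fromSd, SplitExt.fromSd, tensorHom_comp_tensorHom_assoc,
        ← f.isSplitExtHom.κ_comp, ← f.isSplitExtHom.e_comp, Category.assoc,
        f.isSplitExtHom.isBialgHom_p.mul_hom, tensorHom_comp_tensorHom_assoc]).symm

/-- Equal action morphisms give isomorphic actions, by identities. -/
def Act.isoOfEq (B X : BiAlg C) (act act' : B.obj ⊗ X.obj ⟶ X.obj) (h : IsAction B X act)
    (h' : IsAction B X act') (e : act = act') : (⟨B, X, act, h⟩ : Act C) ≅ ⟨B, X, act', h'⟩ where
  hom := ⟨𝟙 _, 𝟙 _, .id _, .id _, by simp [e]⟩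
  inv := ⟨𝟙 _, 𝟙 _, .id _, .id _, by simp [e]⟩
  hom_inv_id := Act.Hom.ext (Category.comp_id _) (Category.comp_id _)
  inv_hom_id := Act.Hom.ext (Category.comp_id _) (Category.comp_id _)

variable (C) in
/-- The natural isomorphism whose components are the identity on `B` and on `X`. -/
def splitExtActCounitIso : actToSplitExt C ⋙ splitExtToAct C ≅ 𝟭 (Act C) :=
  NatIso.ofComponents
    (fun T ↦ Act.isoOfEq T.B T.X _ T.act _ T.isAction T.tensorHom_sdMul_π₁)
    fun _ ↦ Act.Hom.ext ((Category.comp_id _).trans (Category.id_comp _).symm)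
        ((Category.comp_id _).trans (Category.id_comp _).symm)

end

end NonassocBialg

theorem theorem2 {C : Type u} [Category.{v} C] [MonoidalCategory C] [SymmetricCategory C] :
    ∃ (hF : ∀ S : NonassocBialg.SplitExt C,
        NonassocBialg.IsAction S.B S.X S.inducedAct)
      (hF' : ∀ (S S' : NonassocBialg.SplitExt C) (f : S ⟶ S'),
        NonassocBialg.IsActionHom S.inducedAct S'.inducedAct f.g f.v)
      (hG : ∀ T : NonassocBialg.Act C,
        NonassocBialg.IsBialgebra (T.X.obj ⊗ T.B.obj) T.sdOne T.sdMul)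
      (hG' : ∀ T : NonassocBialg.Act C,
        NonassocBialg.IsSplitExtension T.X (T.sd (hG T)) T.B T.i₁ T.π₂ T.i₂ T.π₁)
      (hG'' : ∀ (T T' : NonassocBialg.Act C) (f : T ⟶ T'),
        NonassocBialg.IsSplitExtHom (T.sdSplitExt (hG T) (hG' T))
          (T'.sdSplitExt (hG T') (hG' T')) f.g f.v (f.v ⊗ₘ f.g))
      (E : NonassocBialg.SplitExt C ≌ NonassocBialg.Act C),
      E.functor = NonassocBialg.SplitExt.toAct hF hF' ∧
        E.inverse = NonassocBialg.Act.toSplitExt hG hG' hG'' :=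
  ⟨NonassocBialg.SplitExt.isAction_inducedAct,
    fun _ _ ↦ NonassocBialg.SplitExt.isActionHom_inducedAct,
    NonassocBialg.Act.isBialgebra_sd, NonassocBialg.Act.isSplitExtension_sd,
    fun _ _ ↦ NonassocBialg.Act.isSplitExtHom_sd,
    .mk (NonassocBialg.splitExtToAct C) (NonassocBialg.actToSplitExt C)
      (NonassocBialg.splitExtActUnitIso C) (NonassocBialg.splitExtActCounitIso C), rfl, rfl⟩
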